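/- Let $G$ be a group, let $\theta\colon H\to\theta(H)$ be an isomorphism from a subgroup $H$ of $G$ onto a subgroup $\theta(H)$ of $G$, and let $$\Gamma=\mathrm{HNN}(G,H,\theta)=\langle G,\tau \mid \tau^{-1}h\tau=\theta(h)\ \ \forall h\in H\rangle$$ be the corresponding HNN-extension. Define inductively a decreasing sequence $H_0\supseteq H_1\supseteq\cdots$ of subgroups of $H$ by $H_0=H$ and, for $k\ge 1$, $$H'_k=H_{k-1}\cap\tau^{-1}H_{k-1}\tau=H_{k-1}\cap\theta(H_{k-1}),\qquad H_k=\Big(\bigcap_{g\in G}gH'_kg^{-1}\Big)\cap\tau\Big(\bigcap_{g\in G}gH'_kg^{-1}\Big)\tau^{-1}.$$ A group $\Lambda$ is a *Powers group* if $\Lambda\neq\{1\}$ and if, for every finite subset $F\subset\Lambda\smallsetminus\{1\}$ and every integer $N\ge1$, there exist a partition $\Lambda=C\sqcup D$ and elements $\gamma_1,\dots,\gamma_N\in\Lambda$ such that $fC\cap C=\emptyset$ for all $f\in F$ and $\gamma_jD\cap\gamma_kD=\emptyset$ for all $j\neq k$ in $\{1,\dots,N\}$. A group is *strongly Powers* if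 each of its subnormal subgroups $N\ne\{1\}$ is a Powers group. **Proposition.** Suppose that $\Gamma=\mathrm{HNN}(G,H,\theta)$ is countable, that $H\subsetneqq G$ and $\theta(H)\subsetneqq G$, and that $H_k=\{1\}$ for some $k\ge0$. Then $\Gamma$ is a strongly Powers group. -/

import Mathlib

open scoped Pointwise

/-- A group `Γ` is a Powers group if it is non-trivial and, for every finite `F ⊆ Γ ∖ {1}` and every
integer `N ≥ 1`, there are a partition `Γ = C ⊔ D` and elements `γ₁, …, γ_N` of `Γ` such that
`f C ∩ C = ∅` for all `f ∈ F` and `γ_j D ∩ γ_k D = ∅` for all `j ≠ k`. -/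
def IsPowersGroup (Γ : Type*) [Group Γ] : Prop :=
  Nontrivial Γ ∧
    ∀ F : Finset Γ, (1 : Γ) ∉ F → ∀ N : ℕ, 1 ≤ N →
      ∃ C D : Set Γ, C ∪ D = Set.univ ∧ C ∩ D = ∅ ∧
        ∃ γ : Fin N → Γ,
          (∀ f ∈ F, (f • C) ∩ C = ∅) ∧
          (∀ j k : Fin N, j ≠ k → (γ j • D) ∩ (γ k • D) = ∅)

/-- A group is strongly Powers if each of its subnormal subgroups `N ≠ {1}` is a Powers group. -/
def IsStronglyPowersGroup (Γ : Type*) [Group Γ] : Prop :=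
  ∀ N : Subgroup Γ, N.IsSubnormal → N ≠ ⊥ → IsPowersGroup N

section HNN

variable {G : Type*} [Group G] {H K : Subgroup G}

/-- The stable letter `τ` of `HNN(G, H, θ) = ⟨G, τ | τ⁻¹ h τ = θ(h) ∀ h ∈ H⟩`. Mathlib's stable
letter `t` satisfies `t h t⁻¹ = θ(h)`, so `τ = t⁻¹`. -/
def hnnTau (θ : H ≃* K) : HNNExtension G H K θ := HNNExtension.t⁻¹

/-- The defining relation `τ⁻¹ h τ = θ(h)`. -/
theorem hnnTau_relation (θ : H ≃* K) (h : H) :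
    (hnnTau θ)⁻¹ * HNNExtension.of (h : G) * hnnTau θ = HNNExtension.of (θ h : G) := by
  rw [HNNExtension.equiv_eq_conj, hnnTau, inv_inv]

/-- For a subgroup `S` of `Γ = HNN(G, H, θ)`, the subgroup `⋂_{g ∈ G} g S g⁻¹` of `Γ`. -/
def hnnCore (θ : H ≃* K) (S : Subgroup (HNNExtension G H K θ)) :
    Subgroup (HNNExtension G H K θ) :=
  ⨅ g : G, MulAut.conj (HNNExtension.of g : HNNExtension G H K θ) • S

/-- The subgroup `S ∩ τ⁻¹ S τ` of `Γ = HNN(G, H, θ)`; for `S = H_{k-1}` this is `H'_k`. -/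
def hnnPrime (θ : H ≃* K) (S : Subgroup (HNNExtension G H K θ)) :
    Subgroup (HNNExtension G H K θ) :=
  S ⊓ MulAut.conj (hnnTau θ)⁻¹ • S

/-- The decreasing sequence `H_0 ⊇ H_1 ⊇ ⋯` of subgroups of `H`, viewed inside `Γ = HNN(G, H, θ)`:
`H_0 = H` and, with `H'_k = H_{k-1} ∩ τ⁻¹ H_{k-1} τ`,
`H_k = (⋂_{g ∈ G} g H'_k g⁻¹) ∩ τ (⋂_{g ∈ G} g H'_k g⁻¹) τ⁻¹` for `k ≥ 1`. -/
def hnnSeq (θ : H ≃* K) : ℕ → Subgroup (HNNExtension G H K θ)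
  | 0 => H.map HNNExtension.of
  | k + 1 =>
      hnnCore θ (hnnPrime θ (hnnSeq θ k)) ⊓
        MulAut.conj (hnnTau θ) • hnnCore θ (hnnPrime θ (hnnSeq θ k))

end HNN

/-! `Γ` acts on its Bass–Serre tree, whose vertices are the cosets of `G`. Normal words represent
elements of `Γ`, and a half-tree is encoded as the set of words whose vertex lies beyond a given
edge. As `H` and `θ(H)` are proper, every vertex has at least three edges, so half-trees can be
separated and each contains a ping-pong pair. `H_k` is the pointwise stabilizer of the edges within
distance `k` of a base edge; if it is trivial, only `1` fixes every half-tree inside a given one,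
and every `γ ≠ 1` moves some smaller half-tree off itself (`exists_disjoint_smul_or_eq`,
`eq_one_of_smul_eq`).

A half-tree `U` moved off itself by all of `F` yields `C`; powers of an element pushing the outside
of `U` into `U` separate the translates of `D`. Commutators transfer such elements to normal
subgroups, hence down a subnormal series. -/

section HalfSpaces

/-! ### Ping-pong and abstract half-spaces -/

variable {Γ X : Type*} [Group Γ] [MulAction Γ X]

/-- Every non-zero power of `g` maps the complement of `U` into `U`. -/
def PushesInto (g : Γ) (U : Set X) : Prop :=
  ∀ j : ℤ, j ≠ 0 → ∀ p, p ∉ U → g ^ j • p ∈ U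

theorem PushesInto.conj_of_subset {g : Γ} {U V : Set X} (h : PushesInto g U) (y : Γ)
    (hy : y • U ⊆ V) : PushesInto (y * g * y⁻¹) V := by
  intro j hj p hp
  rw [conj_zpow, mul_smul, mul_smul]
  refine hy (Set.smul_mem_smul_set (h j hj _ fun hU => hp ?_))
  simpa using hy (Set.smul_mem_smul_set (a := y) hU)

theorem PushesInto.mono {g : Γ} {U V : Set X} (h : PushesInto g U) (hUV : U ⊆ V) :
    PushesInto g V := fun j hj p hp => hUV (h j hj p fun hU => hp (hUV hU))

/-- A ping-pong argument: if `g` maps the complement of `Q` into `P`, with `P` and `Q` disjoint,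
then `g` pushes everything into `P ∪ Q`. -/
theorem pushesInto_union {g : Γ} {P Q : Set X} (hPQ : Disjoint P Q)
    (h : ∀ p, p ∉ Q → g • p ∈ P) : PushesInto g (P ∪ Q) := by
  have h' : ∀ p, p ∉ P → g⁻¹ • p ∈ Q := by
    intro p hp
    by_contra hq
    exact hp (by simpa using h _ hq)
  have key : ∀ (n : ℕ) (p : X), p ∉ Q → g ^ (n + 1) • p ∈ P := by
    intro n p hp
    induction n with
    | zero => simpa using h p hp
    | succ n ih =>
      rw [pow_succ', mul_smul]
      exact h _ (Set.disjoint_left.1 hPQ ih)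
  have key' : ∀ (n : ℕ) (p : X), p ∉ P → g⁻¹ ^ (n + 1) • p ∈ Q := by
    intro n p hp
    induction n with
    | zero => simpa using h' p hp
    | succ n ih =>
      rw [pow_succ', mul_smul]
      exact h' _ (Set.disjoint_right.1 hPQ ih)
  intro j hj p hp
  rw [Set.mem_union, not_or] at hp
  rcases lt_or_gt_of_ne hj with hj | hj
  · obtain ⟨n, rfl⟩ : ∃ n : ℕ, j = -((n + 1 : ℕ) : ℤ) := ⟨(-j - 1).toNat, by omega⟩
    right
    rw [zpow_neg, zpow_natCast, ← inv_pow]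
    exact key' n p hp.1
  · obtain ⟨n, rfl⟩ : ∃ n : ℕ, j = ((n + 1 : ℕ) : ℤ) := ⟨(j - 1).toNat, by omega⟩
    left
    rw [zpow_natCast]
    exact key n p hp.2

/-- An invariant family of subsets of a `Γ`-set that behaves like the family of half-trees of a
tree on which `Γ` acts minimally, strongly hyperbolically and slenderly. -/
structure IsHalfSpaceSystem (Γ : Type*) {X : Type*} [Group Γ] [MulAction Γ X]
    (𝓤 : Set (Set X)) : Prop where
  nonempty : 𝓤.Nonempty
  smul_mem : ∀ (γ : Γ), ∀ U ∈ 𝓤, γ • U ∈ 𝓤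
  exists_disjoint : ∀ U ∈ 𝓤, ∀ V ∈ 𝓤, ∃ U' ∈ 𝓤, ∃ V' ∈ 𝓤, U' ⊆ U ∧ V' ⊆ V ∧ Disjoint U' V'
  exists_disjoint_smul : ∀ γ : Γ, γ ≠ 1 → ∀ U ∈ 𝓤, ∃ W ∈ 𝓤, W ⊆ U ∧ Disjoint (γ • W) W
  exists_pushesInto : ∀ U ∈ 𝓤, ∃ g : Γ, PushesInto g U

namespace IsHalfSpaceSystem

variable {𝓤 : Set (Set X)}

theorem exists_disjoint_smul_finset (h𝓤 : IsHalfSpaceSystem Γ 𝓤) (F : Finset Γ)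
    (hF : (1 : Γ) ∉ F) {U : Set X} (hU : U ∈ 𝓤) :
    ∃ W ∈ 𝓤, W ⊆ U ∧ ∀ f ∈ F, Disjoint (f • W) W := by
  classical
  induction F using Finset.induction_on with
  | empty => exact ⟨U, hU, subset_rfl, by simp⟩
  | insert a s _ ih =>
    simp only [Finset.mem_insert, not_or] at hF
    obtain ⟨W, hW, hWU, hWs⟩ := ih hF.2
    obtain ⟨W', hW', hWW', hd⟩ := h𝓤.exists_disjoint_smul a (Ne.symm hF.1) W hW
    refine ⟨W', hW', hWW'.trans hWU, fun f hf => ?_⟩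
    rcases Finset.mem_insert.1 hf with rfl | hf
    · exact hd
    · exact (hWs f hf).mono (Set.smul_set_mono hWW') hWW'

theorem isPowersGroup [Nonempty X] (h𝓤 : IsHalfSpaceSystem Γ 𝓤) {N : Subgroup Γ} (hN : N ≠ ⊥)
    (hpush : ∀ U ∈ 𝓤, ∃ g ∈ N, PushesInto g U) : IsPowersGroup N := by
  classical
  refine ⟨(Subgroup.nontrivial_iff_ne_bot N).2 hN, fun F hF n _ => ?_⟩
  obtain ⟨x₀⟩ := ‹Nonempty X›
  obtain ⟨U₀, hU₀⟩ := h𝓤.nonempty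
  obtain ⟨U, hU, -, hFU⟩ := h𝓤.exists_disjoint_smul_finset
    (F.map ⟨Subtype.val, Subtype.val_injective⟩) (by simpa using fun h => hF h) hU₀
  obtain ⟨g, hg, hgU⟩ := hpush U hU
  -- The partition of `X` into `U` and its complement is pulled back along the orbit map of `x₀`.
  refine ⟨{γ | γ • x₀ ∈ U}, {γ | γ • x₀ ∉ U}, ?_, ?_, fun i => ⟨g, hg⟩ ^ (i : ℤ), ?_, ?_⟩
  · ext γ
    simp [em]
  · ext γ
    simp
  · intro f hf
    rw [Set.eq_empty_iff_forall_notMem]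
    rintro _ ⟨⟨c, hc, rfl⟩, hc'⟩
    refine Set.disjoint_left.1 (hFU f (by simpa using hf)) (Set.smul_mem_smul_set hc) ?_
    simpa [mul_smul, Subgroup.smul_def] using hc'
  · intro j k hjk
    rw [Set.eq_empty_iff_forall_notMem]
    rintro _ ⟨⟨c, hc, rfl⟩, ⟨c', hc', h⟩⟩
    have hjk' : (j : ℤ) - k ≠ 0 := by
      rw [sub_ne_zero]
      exact_mod_cast fun h => hjk (Fin.ext h)
    refine hc' ?_
    have : c' = (⟨g, hg⟩ : N) ^ ((j : ℤ) - k) * c := by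
      rw [sub_eq_neg_add, zpow_add, zpow_neg, mul_assoc, eq_inv_mul_iff_mul_eq]
      exact h
    change c' • x₀ ∈ U
    rw [this, mul_smul]
    exact hgU _ hjk' _ hc

theorem exists_pushesInto_of_normal (h𝓤 : IsHalfSpaceSystem Γ 𝓤) {M N : Subgroup Γ} (hMN : M ≤ N)
    (hnormal : (M.subgroupOf N).Normal) (hM : M ≠ ⊥)
    (hpush : ∀ U ∈ 𝓤, ∃ g ∈ N, PushesInto g U) :
    ∀ V ∈ 𝓤, ∃ g ∈ M, PushesInto g V := by
  intro V hV
  have hconj : ∀ n ∈ N, ∀ m ∈ M, n * m * n⁻¹ ∈ M := fun n hn m hm => by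
    simpa [Subgroup.mem_subgroupOf] using hnormal.conj_mem ⟨m, hMN hm⟩ hm ⟨n, hn⟩
  obtain ⟨m, hm, hm1⟩ := (Subgroup.ne_bot_iff_exists_ne_one.1 hM).elim
    fun a ha => (⟨a, a.2, by simpa using ha⟩ : ∃ m ∈ M, m ≠ 1)
  obtain ⟨U, hU, -, hmU⟩ := h𝓤.exists_disjoint_smul m hm1 V hV
  -- Shrinking makes both `W` and `m • W` miss `m • V₂ ⊆ V`, so that `y` carries their union into
  -- `V`.
  obtain ⟨W₁, hW₁, V₁, hV₁, hWU₁, hVV₁, hd₁⟩ := h𝓤.exists_disjoint U hU V hV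
  obtain ⟨W, hW, V₂, hV₂, hWU₂, hVV₂, hd₂⟩ :=
    h𝓤.exists_disjoint W₁ hW₁ (m⁻¹ • V₁) (h𝓤.smul_mem _ _ hV₁)
  have hWm : Disjoint (m • W) W :=
    hmU.mono (Set.smul_set_mono (hWU₂.trans hWU₁)) (hWU₂.trans hWU₁)
  have hVV : m • V₂ ⊆ V₁ := by simpa [Set.subset_smul_set_iff] using hVV₂
  obtain ⟨g, hg, hgW⟩ := hpush W hW
  obtain ⟨y, hy, hyV⟩ := hpush (m • V₂) (h𝓤.smul_mem _ _ hV₂)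
  -- Outside `W`, `g⁻¹` leads into `W`, `m⁻¹` out of it, `g` back into `W`, and `m` into `m • W`.
  have hx : PushesInto (m * (g * m⁻¹ * g⁻¹)) (m • W ∪ W) := by
    refine pushesInto_union hWm fun p hp => ?_
    rw [mul_smul]
    refine Set.smul_mem_smul_set ?_
    rw [mul_smul, mul_smul]
    have h1 : g⁻¹ • p ∈ W := by simpa using hgW (-1) (by simp) p hp
    have h2 : m⁻¹ • g⁻¹ • p ∉ W := fun h =>
      Set.disjoint_left.1 hWm (by simpa using Set.smul_mem_smul_set (a := m) h) h1
    simpa using hgW 1 (by simp) _ h2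
  refine ⟨y * (m * (g * m⁻¹ * g⁻¹)) * y⁻¹,
    hconj _ hy _ (M.mul_mem hm (hconj _ hg _ (M.inv_mem hm))), hx.conj_of_subset y ?_⟩
  rintro _ ⟨p, hp, rfl⟩
  refine hVV₁ (hVV ?_)
  have : p ∉ m • V₂ := by
    intro hpV
    rcases hp with hp | hp
    · exact Set.disjoint_left.1 (Set.disjoint_smul_set.2 hd₂) hp hpV
    · exact Set.disjoint_left.1 hd₁ (hWU₂ hp) (hVV hpV)
  simpa using hyV 1 (by simp) p this

theorem isStronglyPowersGroup [Nonempty X] (h𝓤 : IsHalfSpaceSystem Γ 𝓤) :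
    IsStronglyPowersGroup Γ := by
  intro N hN hne
  refine h𝓤.isPowersGroup hne ?_
  induction hN with
  | top => exact fun U hU => (h𝓤.exists_pushesInto U hU).imp fun g hg => ⟨trivial, hg⟩
  | step M N hMN _ hnormal ih =>
    exact h𝓤.exists_pushesInto_of_normal hMN hnormal hne
      (ih fun h => hne (le_bot_iff.1 (h ▸ hMN)))

end IsHalfSpaceSystem

end HalfSpaces

/-! ### Half-trees as sets of normal words -/

namespace HNNExtension

open NormalWord

variable {G : Type*} [Group G] {H K : Subgroup G} (θ : H ≃* K) (d : TransversalPair G H K)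

local notation "Γ" => HNNExtension G H K θ

/-- The normal words whose first letter is `t ^ u`, up to a head in `toSubgroup H K (-u)`. -/
def halfTree (u : ℤˣ) : Set (NormalWord d) :=
  {w | w.head ∈ toSubgroup H K (-u) ∧ w.toList.head?.map Prod.fst = some u}

variable {d}

theorem of_smul_mem_halfTree {g : G} {u : ℤˣ} {w : NormalWord d} :
    (of g : Γ) • w ∈ halfTree d u ↔
      g * w.head ∈ toSubgroup H K (-u) ∧ w.toList.head?.map Prod.fst = some u := by
  rw [of_smul_eq_smul]
  rfl

theorem mem_of_smul_halfTree {g : G} {u : ℤˣ} {w : NormalWord d} :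
    w ∈ (of g : Γ) • halfTree d u ↔
      g⁻¹ * w.head ∈ toSubgroup H K (-u) ∧ w.toList.head?.map Prod.fst = some u := by
  rw [Set.mem_smul_set_iff_inv_smul_mem, ← map_inv, of_smul_mem_halfTree]

theorem empty_notMem_of_smul_halfTree (g : G) (u : ℤˣ) :
    (empty : NormalWord d) ∉ (of g : Γ) • halfTree d u := by
  simp [mem_of_smul_halfTree]

theorem empty_notMem_halfTree (u : ℤˣ) : (empty : NormalWord d) ∉ halfTree d u := by
  simp [halfTree]

/-- The half-trees based at the same vertex are equal or disjoint. -/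
theorem of_smul_halfTree_eq_or_disjoint (g g' : G) (u u' : ℤˣ) :
    ((of g : Γ) • halfTree d u = (of g' : Γ) • halfTree d u' ∧
        u = u' ∧ g⁻¹ * g' ∈ toSubgroup H K (-u)) ∨
      Disjoint ((of g : Γ) • halfTree d u)
        ((of g' : Γ) • halfTree d u') := by
  by_cases h : u = u' ∧ g⁻¹ * g' ∈ toSubgroup H K (-u)
  · left
    refine ⟨?_, h⟩
    obtain ⟨rfl, h⟩ := h
    ext w
    rw [mem_of_smul_halfTree, mem_of_smul_halfTree,
      ← Subgroup.mul_mem_cancel_left (y := g'⁻¹ * w.head) _ h]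
    simp [mul_assoc]
  · right
    rw [Set.disjoint_left]
    intro w hw hw'
    rw [mem_of_smul_halfTree] at hw hw'
    obtain rfl : u = u' := by simpa [hw.2] using hw'.2
    refine h ⟨rfl, ?_⟩
    simpa [mul_assoc] using Subgroup.mul_mem _ hw.1 (Subgroup.inv_mem _ hw'.1)

theorem disjoint_of_smul_halfTree {g g' : G} {u u' : ℤˣ}
    (h : u = u' → g⁻¹ * g' ∉ toSubgroup H K (-u)) :
    Disjoint ((of g : Γ) • halfTree d u) ((of g' : Γ) • halfTree d u') :=
  (of_smul_halfTree_eq_or_disjoint θ g g' u u').resolve_left fun h' => h h'.2.1 h'.2.2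

/-- The letter `t ^ v` becomes the new first letter unless it cancels, which happens exactly on
`halfTree d (-v)`. -/
theorem t_zpow_smul_mem_halfTree (v : ℤˣ) (w : NormalWord d) :
    (t ^ (v : ℤ) : Γ) • w ∈ halfTree d v ↔ w ∉ halfTree d (-v) := by
  rw [t_pow_smul_eq_unitsSMul]
  have := unitsSMul_cancels_iff θ v w
  simpa only [Cancels, halfTree, Set.mem_ofPred_eq, neg_neg] using this

theorem t_zpow_smul_compl_halfTree (u : ℤˣ) :
    (t ^ (u : ℤ) : Γ) • (halfTree d (-u))ᶜ = halfTree d u := by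
  ext w
  rw [Set.mem_smul_set_iff_inv_smul_mem, Set.mem_compl_iff, ← t_zpow_smul_mem_halfTree θ,
    smul_inv_smul]

theorem t_zpow_smul_halfTree (u : ℤˣ) :
    (t ^ (u : ℤ) : Γ) • halfTree d (-u) = (halfTree d u)ᶜ := by
  rw [← t_zpow_smul_compl_halfTree θ u, Set.smul_set_compl, compl_compl]

theorem t_zpow_smul_subset_halfTree {u : ℤˣ} {Y : Set (NormalWord d)}
    (hY : Disjoint Y (halfTree d (-u))) : (t ^ (u : ℤ) : Γ) • Y ⊆ halfTree d u := by
  rw [← t_zpow_smul_compl_halfTree θ u]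
  exact Set.smul_set_mono (Set.subset_compl_iff_disjoint_right.2 hY)

include θ in
theorem halfTree_nonempty (u : ℤˣ) : (halfTree d u).Nonempty :=
  ⟨(t ^ (u : ℤ) : Γ) • empty, (t_zpow_smul_mem_halfTree θ u empty).2 (empty_notMem_halfTree _)⟩

theorem halfTree_eq_or_disjoint (g : G) (u u' : ℤˣ) :
    (of g : Γ) • halfTree d u = halfTree d u' ∨
      Disjoint ((of g : Γ) • halfTree d u) (halfTree d u') := by
  have := of_smul_halfTree_eq_or_disjoint θ (d := d) g 1 u u'
  rw [map_one, one_smul] at this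
  exact this.imp And.left id

theorem disjoint_halfTree_neg (u : ℤˣ) : Disjoint (halfTree d u) (halfTree d (-u)) := by
  rw [Set.disjoint_left]
  intro w hw hw'
  have := hw.2.symm.trans hw'.2
  simp at this

/-- A translate of a half-tree, or its complement, is contained in the half-tree based at the
trivial vertex that is determined by the first letter of the translating element. -/
theorem prod_smul_halfTree_subset (w : NormalWord d) (v : ℤˣ) :
    ∀ u ∈ w.toList.head?.map Prod.fst,
      w.prod θ • halfTree d v ⊆ (of w.head : Γ) • halfTree d u ∨
        (w.prod θ • halfTree d v)ᶜ ⊆ (of w.head : Γ) • halfTree d u := by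
  induction w using consRecOn with
  | ofGroup g => simp
  | cons g u w h1 h2 ih =>
    intro u' hu'
    obtain rfl : u = u' := by simpa using hu'
    rw [prod_cons, cons_head, mul_smul, mul_smul, ← Set.smul_set_compl, ← Set.smul_set_compl,
      Set.smul_set_subset_smul_set_iff, Set.smul_set_subset_smul_set_iff]
    rcases hl : w.toList.head?.map Prod.fst with _ | u'
    · have hw : w.prod θ = of w.head := by
        have : w.toList = [] := by simpa using hl
        simp [ReducedWord.prod, this]
      rw [hw]
      rcases halfTree_eq_or_disjoint θ (d := d) w.head v (-u) with h | h
      · right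
        rw [h, t_zpow_smul_compl_halfTree]
      · left
        exact t_zpow_smul_subset_halfTree θ h
    · have hd : Disjoint ((of w.head : Γ) • halfTree d u') (halfTree d (-u)) := by
        have := disjoint_of_smul_halfTree θ (d := d) (g := 1) (g' := w.head) (u := -u) (u' := u') <| by
          rintro rfl
          have := h2 (-u) hl
          rw [inv_one, one_mul, neg_neg]
          intro hm
          simpa using this hm
        rw [map_one, one_smul] at this
        exact this.symm
      exact (ih u' hl).imp (fun h => t_zpow_smul_subset_halfTree θ (hd.mono_left h))
        fun h => t_zpow_smul_subset_halfTree θ (hd.mono_left h)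

/-- The side of the translated edge away from the trivial vertex lies in a single branch at that
vertex. -/
theorem smul_halfTree_dichotomy (γ : Γ) (v : ℤˣ) :
    ∃ (g : G) (u : ℤˣ), γ • halfTree d v ⊆ (of g : Γ) • halfTree d u ∨
      (γ • halfTree d v)ᶜ ⊆ (of g : Γ) • halfTree d u := by
  obtain ⟨w, rfl⟩ := (NormalWord.equiv θ d).symm.surjective γ
  change ∃ g u, w.prod θ • halfTree d v ⊆ _ ∨ (w.prod θ • halfTree d v)ᶜ ⊆ _
  rcases hl : w.toList.head?.map Prod.fst with _ | u
  · have hw : w.prod θ = of w.head := by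
      have : w.toList = [] := by simpa using hl
      simp [ReducedWord.prod, this]
    exact ⟨w.head, v, Or.inl (by rw [hw])⟩
  · exact ⟨w.head, u, prod_smul_halfTree_subset θ w v u hl⟩

theorem exists_of_smul_halfTree_eq {γ : Γ} {u : ℤˣ} (hγ : γ • halfTree d u = halfTree d u) :
    ∃ a ∈ toSubgroup H K (-u), of a = γ := by
  obtain ⟨w, rfl⟩ := (NormalWord.equiv θ d).symm.surjective γ
  change w.prod θ • halfTree d u = halfTree d u at hγ
  change ∃ a ∈ toSubgroup H K (-u), of a = w.prod θ
  rcases hl : w.toList.head?.map Prod.fst with _ | v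
  · have hw : w.prod θ = of w.head := by
      have : w.toList = [] := by simpa using hl
      simp [ReducedWord.prod, this]
    rw [hw] at hγ ⊢
    refine ⟨w.head, ?_, rfl⟩
    have := of_smul_halfTree_eq_or_disjoint θ (d := d) w.head 1 u u
    rw [map_one, one_smul] at this
    rcases this with h | h
    · simpa using h.2.2
    · rw [hγ, disjoint_self] at h
      exact absurd h (halfTree_nonempty θ u).ne_empty
  · exfalso
    -- `w` is the image of `empty`, which lies outside the preserved half-tree.
    have hw : w ∉ halfTree d u := by
      rw [← hγ, ← prod_smul_empty (φ := θ) w, prod_smul, prod_empty, mul_one,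
        Set.smul_mem_smul_set_iff]
      exact empty_notMem_halfTree u
    have hw' : w ∈ (of w.head : Γ) • halfTree d v := by
      rw [mem_of_smul_halfTree, inv_mul_cancel]
      exact ⟨one_mem _, hl⟩
    have h := prod_smul_halfTree_subset θ w u v hl
    rw [hγ] at h
    rcases h with h | h
    · rcases halfTree_eq_or_disjoint θ (d := d) w.head v u with h' | h'
      · exact hw (h' ▸ hw')
      · exact (halfTree_nonempty θ u).ne_empty (disjoint_self.1 (h'.mono_left h))
    · exact empty_notMem_of_smul_halfTree θ _ _ (h (empty_notMem_halfTree u))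

/-! ### Separating and moving half-trees -/

variable (d) in
/-- The translates of the two basic half-trees. -/
def halfTrees : Set (Set (NormalWord d)) :=
  {U | ∃ (x : Γ) (u : ℤˣ), U = x • halfTree d u}

theorem smul_mem_halfTrees (γ : Γ) {U : Set (NormalWord d)} (hU : U ∈ halfTrees θ d) :
    γ • U ∈ halfTrees θ d := by
  obtain ⟨x, u, rfl⟩ := hU
  exact ⟨γ * x, u, smul_smul _ _ _⟩

theorem smul_halfTree_mem_halfTrees (γ : Γ) (u : ℤˣ) : γ • halfTree d u ∈ halfTrees θ d :=
  ⟨γ, u, rfl⟩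

theorem halfTree_mem_halfTrees (u : ℤˣ) : halfTree d u ∈ halfTrees θ d :=
  ⟨1, u, (one_smul _ _).symm⟩

theorem compl_mem_halfTrees {U : Set (NormalWord d)} (hU : U ∈ halfTrees θ d) :
    Uᶜ ∈ halfTrees θ d := by
  obtain ⟨x, u, rfl⟩ := hU
  rw [← Set.smul_set_compl, ← t_zpow_smul_halfTree θ]
  exact smul_mem_halfTrees θ _ (smul_halfTree_mem_halfTrees θ _ _)

theorem exists_notMem_toSubgroup (hH : H ≠ ⊤) (hK : K ≠ ⊤) (u : ℤˣ) :
    ∃ g : G, g ∉ toSubgroup H K u := by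
  by_contra! h
  rcases Int.units_eq_one_or u with rfl | rfl
  · exact hH ((Subgroup.eq_top_iff' _).2 h)
  · exact hK ((Subgroup.eq_top_iff' _).2 h)

/-- At least three half-trees are based at the trivial vertex. -/
theorem exists_disjoint_of_smul_halfTree (hH : H ≠ ⊤) (hK : K ≠ ⊤) (g : G) (u v : ℤˣ) :
    ∃ (g' : G) (u' : ℤˣ), Disjoint ((of g' : Γ) • halfTree d u') ((of g : Γ) • halfTree d u) ∧
      Disjoint ((of g' : Γ) • halfTree d u') (halfTree d v) := by
  have key : ∀ (g' : G) (u' : ℤˣ), (u' = v → g' ∉ toSubgroup H K (-u')) →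
      Disjoint ((of g' : Γ) • halfTree d u') (halfTree d v) := by
    intro g' u' h
    have := disjoint_of_smul_halfTree θ (d := d) (g := g') (g' := 1) (u := u') (u' := v)
      (by simpa using h)
    rwa [map_one, one_smul] at this
  by_cases huv : u = v
  · subst huv
    exact ⟨1, -u, disjoint_of_smul_halfTree θ (by simp), key _ _ (by simp)⟩
  · obtain ⟨a, ha⟩ := exists_notMem_toSubgroup hH hK (-u)
    refine ⟨g * a, u, disjoint_of_smul_halfTree θ ?_, key _ _ (fun h => absurd h huv)⟩
    simpa [mul_assoc] using ha

/-- Every half-tree contains two disjoint half-trees pointing in opposite directions. -/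
theorem exists_disjoint_subset_halfTree (hH : H ≠ ⊤) (hK : K ≠ ⊤) (u : ℤˣ) :
    ∃ x y : Γ, x • halfTree d u ⊆ halfTree d u ∧ y • halfTree d (-u) ⊆ halfTree d u ∧
      Disjoint (x • halfTree d u) (y • halfTree d (-u)) := by
  obtain ⟨g, hg⟩ := exists_notMem_toSubgroup hH hK u
  have h1 : Disjoint ((of g : Γ) • halfTree d (-u)) (halfTree d (-u)) := by
    have := disjoint_of_smul_halfTree θ (d := d) (g := g) (g' := 1) (u := -u) (u' := -u)
      (by simpa using hg)
    rwa [map_one, one_smul] at this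
  have h2 : Disjoint (halfTree d u) ((of g : Γ) • halfTree d (-u)) := by
    have := disjoint_of_smul_halfTree θ (d := d) (g := 1) (g' := g) (u := u) (u' := -u) (by simp)
    rwa [map_one, one_smul] at this
  refine ⟨t ^ (u : ℤ), t ^ (u : ℤ) * of g,
    t_zpow_smul_subset_halfTree θ (disjoint_halfTree_neg u), ?_, ?_⟩
  · rw [mul_smul]
    exact t_zpow_smul_subset_halfTree θ h1
  · rw [mul_smul, Set.disjoint_smul_set]
    exact h2

theorem exists_disjoint_subset (hH : H ≠ ⊤) (hK : K ≠ ⊤) {U : Set (NormalWord d)}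
    (hU : U ∈ halfTrees θ d) :
    ∃ U₁ ∈ halfTrees θ d, ∃ U₂ ∈ halfTrees θ d, U₁ ⊆ U ∧ U₂ ⊆ U ∧ Disjoint U₁ U₂ := by
  obtain ⟨z, u, rfl⟩ := hU
  obtain ⟨x, y, hx, hy, hd⟩ := exists_disjoint_subset_halfTree θ (d := d) hH hK u
  exact ⟨z • x • halfTree d u, smul_mem_halfTrees θ _ (smul_halfTree_mem_halfTrees θ _ _),
    z • y • halfTree d (-u), smul_mem_halfTrees θ _ (smul_halfTree_mem_halfTrees θ _ _),
    Set.smul_set_mono hx, Set.smul_set_mono hy, Set.disjoint_smul_set.2 hd⟩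

/-- `t ^ u` sends the outside of `halfTree d (-u)` onto `halfTree d u`; composing with `x` and `y⁻¹`
places both inside `U`. -/
theorem exists_pushesInto_halfTrees (hH : H ≠ ⊤) (hK : K ≠ ⊤) {U : Set (NormalWord d)}
    (hU : U ∈ halfTrees θ d) : ∃ g : Γ, PushesInto g U := by
  obtain ⟨z, u, rfl⟩ := hU
  obtain ⟨x, y, hx, hy, hd⟩ := exists_disjoint_subset_halfTree θ (d := d) hH hK u
  suffices h : PushesInto (x * t ^ (u : ℤ) * y⁻¹) (halfTree d u) from
    ⟨_, h.conj_of_subset z subset_rfl⟩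
  refine (pushesInto_union hd fun p hp => ?_).mono (Set.union_subset hx hy)
  rw [mul_smul, mul_smul, ← t_zpow_smul_compl_halfTree θ]
  refine Set.smul_mem_smul_set (Set.smul_mem_smul_set fun h => hp ?_)
  rwa [Set.mem_smul_set_iff_inv_smul_mem]

theorem exists_disjoint_halfTrees (hH : H ≠ ⊤) (hK : K ≠ ⊤) {U V : Set (NormalWord d)}
    (hU : U ∈ halfTrees θ d) (hV : V ∈ halfTrees θ d) :
    ∃ U' ∈ halfTrees θ d, ∃ V' ∈ halfTrees θ d, U' ⊆ U ∧ V' ⊆ V ∧ Disjoint U' V' := by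
  have key : ∀ (u : ℤˣ), ∀ V ∈ halfTrees θ d, ∃ U' ∈ halfTrees θ d, ∃ V' ∈ halfTrees θ d,
      U' ⊆ halfTree d u ∧ V' ⊆ V ∧ Disjoint U' V' := by
    intro u V hV
    have hU := halfTree_mem_halfTrees θ (d := d) u
    obtain ⟨y, v, hy⟩ := id hV
    obtain ⟨g, u', h⟩ := smul_halfTree_dichotomy θ (d := d) y v
    rw [← hy] at h
    rcases halfTree_eq_or_disjoint θ (d := d) g u' u with h' | h' <;> rcases h with h | h
    · rw [h'] at h
      obtain ⟨V₁, hV₁, V₂, hV₂, h₁, h₂, hd⟩ := exists_disjoint_subset θ hH hK hV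
      exact ⟨V₁, hV₁, V₂, hV₂, h₁.trans h, h₂, hd⟩
    · rw [h'] at h
      exact ⟨Vᶜ, compl_mem_halfTrees θ hV, V, hV, h, subset_rfl, disjoint_compl_left⟩
    · exact ⟨_, hU, V, hV, subset_rfl, subset_rfl, (h'.mono_left h).symm⟩
    · obtain ⟨V₁, hV₁, V₂, hV₂, h₁, h₂, hd⟩ := exists_disjoint_subset θ hH hK hU
      have hUV : halfTree d u ⊆ V := by
        rw [← Set.disjoint_compl_right_iff_subset]
        exact (h'.mono_left h).symm
      exact ⟨V₁, hV₁, V₂, hV₂, h₁, h₂.trans hUV, hd⟩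
  obtain ⟨x, u, rfl⟩ := hU
  obtain ⟨U', hU', V', hV', h₁, h₂, hd⟩ := key u (x⁻¹ • V) (smul_mem_halfTrees θ _ hV)
  refine ⟨x • U', smul_mem_halfTrees θ _ hU', x • V', smul_mem_halfTrees θ _ hV',
    Set.smul_set_mono h₁, ?_, Set.disjoint_smul_set.2 hd⟩
  simpa [Set.subset_smul_set_iff] using h₂

theorem exists_disjoint_smul_or_eq_of_subset (hH : H ≠ ⊤) (hK : K ≠ ⊤) {γ : Γ} {u : ℤˣ}
    (hγ : γ • halfTree d u ⊆ halfTree d u) :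
    (∃ W ∈ halfTrees θ d, W ⊆ halfTree d u ∧ Disjoint (γ • W) W) ∨
      γ • halfTree d u = halfTree d u := by
  obtain ⟨s, hs⟩ : ∃ s : Γ, s = t ^ (u : ℤ) := ⟨_, rfl⟩
  have hsu : s • (halfTree d (-u))ᶜ = halfTree d u := by rw [hs, t_zpow_smul_compl_halfTree]
  obtain ⟨g, v, h⟩ := smul_halfTree_dichotomy θ (d := d) (s⁻¹ * γ) u
  have hsub : (s⁻¹ * γ) • halfTree d u ⊆ (halfTree d (-u))ᶜ := by
    rw [mul_smul, ← Set.subset_smul_set_iff, hsu]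
    exact hγ
  rcases h with h | h
  · left
    -- At the far vertex `s` of the edge, `W` is a third branch, avoiding both the way back and the
    -- branch containing `γ • halfTree d u`.
    obtain ⟨g', u', h₁, h₂⟩ := exists_disjoint_of_smul_halfTree θ (d := d) hH hK g v (-u)
    have hW : s • (of g' : Γ) • halfTree d u' ⊆ halfTree d u := by
      rw [hs]
      exact t_zpow_smul_subset_halfTree θ h₂
    refine ⟨s • (of g' : Γ) • halfTree d u',
      smul_mem_halfTrees θ _ (smul_halfTree_mem_halfTrees θ _ _), hW, ?_⟩
    refine Disjoint.mono_left (Set.smul_set_mono hW) ?_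
    rw [Set.disjoint_smul_set_right, smul_smul]
    exact (h₁.mono_right h).symm
  · right
    have h1 : halfTree d (-u) ⊆ ((s⁻¹ * γ) • halfTree d u)ᶜ := Set.subset_compl_comm.1 hsub
    have h2 : (of g : Γ) • halfTree d v = halfTree d (-u) := by
      refine (halfTree_eq_or_disjoint θ (d := d) g v (-u)).resolve_right fun hd => ?_
      exact (halfTree_nonempty θ (-u)).ne_empty (disjoint_self.1 (hd.mono_left (h1.trans h)))
    rw [h2] at h
    refine hγ.antisymm ?_
    have h3 := Set.smul_set_mono (a := s) (Set.compl_subset_comm.1 h)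
    rwa [hsu, smul_smul, mul_inv_cancel_left] at h3

theorem exists_disjoint_smul_or_eq (hH : H ≠ ⊤) (hK : K ≠ ⊤) (γ : Γ) {U : Set (NormalWord d)}
    (hU : U ∈ halfTrees θ d) :
    (∃ W ∈ halfTrees θ d, W ⊆ U ∧ Disjoint (γ • W) W) ∨ γ • U = U := by
  have key : ∀ (γ : Γ) (u : ℤˣ),
      (∃ W ∈ halfTrees θ d, W ⊆ halfTree d u ∧ Disjoint (γ • W) W) ∨
        γ • halfTree d u = halfTree d u := by
    intro γ u
    obtain ⟨g, v, h⟩ := smul_halfTree_dichotomy θ (d := d) γ u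
    rcases halfTree_eq_or_disjoint θ (d := d) g v u with h' | h' <;> rcases h with h | h
    · exact exists_disjoint_smul_or_eq_of_subset θ hH hK (h.trans h'.subset)
    · left
      rw [h'] at h
      refine ⟨γ⁻¹ • (halfTree d u)ᶜ,
        smul_mem_halfTrees θ _ (compl_mem_halfTrees θ (halfTree_mem_halfTrees θ u)), ?_⟩
      have hsub : γ⁻¹ • (halfTree d u)ᶜ ⊆ halfTree d u := by
        rw [← Set.subset_smul_set_iff]
        exact Set.compl_subset_comm.1 h
      refine ⟨hsub, ?_⟩
      rw [smul_inv_smul]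
      exact disjoint_compl_left.mono_right hsub
    · exact Or.inl ⟨_, halfTree_mem_halfTrees θ u, subset_rfl, h'.mono_left h⟩
    · have hsub : γ⁻¹ • halfTree d u ⊆ halfTree d u := by
        rw [← Set.subset_smul_set_iff, ← Set.disjoint_compl_right_iff_subset]
        exact (h'.mono_left h).symm
      rcases exists_disjoint_smul_or_eq_of_subset θ hH hK hsub with ⟨W, hW, hWU, hd⟩ | h
      · refine Or.inl ⟨W, hW, hWU, ?_⟩
        rw [Set.disjoint_smul_set_left]
        exact hd.symm
      · exact Or.inr (inv_smul_eq_iff.1 h).symm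
  obtain ⟨x, u, rfl⟩ := hU
  rcases key (x⁻¹ * γ * x) u with ⟨W, hW, hWU, hd⟩ | h
  · refine Or.inl ⟨x • W, smul_mem_halfTrees θ _ hW, Set.smul_set_mono hWU, ?_⟩
    rw [← Set.disjoint_smul_set (a := x), smul_smul] at hd
    simpa [mul_smul] using hd
  · right
    rw [← smul_left_cancel_iff x] at h
    simpa [mul_smul] using h

/-! ### Fixed edges and the sequence `H_k` -/

/-- The edge `x` of the Bass–Serre tree lies in the part of the tree cut out by `U`. -/
def EdgeIn (x : Γ) (U : Set (NormalWord d)) : Prop :=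
  x • halfTree d (-1) ⊆ U ∨ (x • halfTree d (-1))ᶜ ⊆ U

theorem edgeIn_mul_smul {x a : Γ} {U : Set (NormalWord d)} :
    EdgeIn θ (a * x) (a • U) ↔ EdgeIn θ x U := by
  rw [EdgeIn, EdgeIn, mul_smul, ← Set.smul_set_compl, Set.smul_set_subset_smul_set_iff,
    Set.smul_set_subset_smul_set_iff]

/-- If one of the edges at the vertex `z` is in the half-tree `halfTree d u`, then every edge at
this vertex is in the larger half-tree `(halfTree d (-u))ᶜ`. -/
theorem smul_of_smul_halfTree_subset {z : Γ} {u v : ℤˣ}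
    (h : z • halfTree d v ⊆ halfTree d u ∨ (z • halfTree d v)ᶜ ⊆ halfTree d u) (g : G) (v' : ℤˣ) :
    z • (of g : Γ) • halfTree d v' ⊆ (halfTree d (-u))ᶜ ∨
      (z • (of g : Γ) • halfTree d v')ᶜ ⊆ (halfTree d (-u))ᶜ := by
  have hu : halfTree d u ⊆ (halfTree d (-u))ᶜ :=
    Set.subset_compl_iff_disjoint_right.2 (disjoint_halfTree_neg u)
  obtain ⟨g₀, v₀, h₀⟩ := smul_halfTree_dichotomy θ (d := d) z⁻¹ (-u)
  rw [← Set.smul_set_compl, ← Set.subset_smul_set_iff, ← Set.subset_smul_set_iff] at h₀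
  rcases h₀ with h₀ | h₀
  · rcases of_smul_halfTree_eq_or_disjoint θ (d := d) g g₀ v' v₀ with h' | h'
    · right
      rw [h'.1]
      exact Set.compl_subset_compl.2 h₀
    · left
      exact Set.subset_compl_iff_disjoint_right.2 ((Set.disjoint_smul_set.2 h').mono_right h₀)
  · exfalso
    rcases h with h | h
    · have h1 : halfTree d v ⊆ (of g₀ : Γ) • halfTree d v₀ := by
        rw [← Set.smul_set_subset_smul_set_iff (a := z)]
        exact h.trans (hu.trans h₀)
      rcases halfTree_eq_or_disjoint θ (d := d) g₀ v₀ v with h' | h'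
      · rw [h'] at h₀
        exact empty_notMem_halfTree u (h (h₀ (empty_notMem_halfTree (-u))))
      · exact (halfTree_nonempty θ v).ne_empty (disjoint_self.1 (h'.mono_left h1))
    · have h1 : z • empty ∈ (z • halfTree d v)ᶜ := by
        rw [Set.mem_compl_iff, Set.smul_mem_smul_set_iff]
        exact empty_notMem_halfTree v
      have h2 := h₀ (hu (h h1))
      rw [Set.smul_mem_smul_set_iff] at h2
      exact empty_notMem_of_smul_halfTree θ _ _ h2

theorem EdgeIn.adjacent {x : Γ} {u : ℤˣ}
    (h : EdgeIn θ x ((t ^ (u : ℤ) : Γ) • halfTree d u)) (g : G) :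
    EdgeIn θ (x * of g) (halfTree d u) ∧ EdgeIn θ (x * (of g * t)) (halfTree d u) ∧
      EdgeIn θ (x * (t⁻¹ * of g)) (halfTree d u) ∧
      EdgeIn θ (x * (t⁻¹ * of g * t)) (halfTree d u) := by
  obtain ⟨s, hs⟩ : ∃ s : Γ, s = t ^ (u : ℤ) := ⟨_, rfl⟩
  have hsu : s • (halfTree d (-u))ᶜ = halfTree d u := by rw [hs, t_zpow_smul_compl_halfTree]
  have ht : (t : Γ) • halfTree d (-1) = (halfTree d 1)ᶜ := by
    simpa using t_zpow_smul_halfTree θ (d := d) 1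
  have key : ∀ (z : Γ) (v : ℤˣ), (z • halfTree d v ⊆ s • halfTree d u ∨
      (z • halfTree d v)ᶜ ⊆ s • halfTree d u) →
      EdgeIn θ (z * of g) (halfTree d u) ∧ EdgeIn θ (z * (of g * t)) (halfTree d u) := by
    intro z v hz
    have hz' : (s⁻¹ * z) • halfTree d v ⊆ halfTree d u ∨
        ((s⁻¹ * z) • halfTree d v)ᶜ ⊆ halfTree d u := by
      simpa only [mul_smul, ← Set.smul_set_compl, ← Set.subset_smul_set_iff] using hz
    have h : ∀ v' : ℤˣ, z • (of g : Γ) • halfTree d v' ⊆ halfTree d u ∨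
        (z • (of g : Γ) • halfTree d v')ᶜ ⊆ halfTree d u := fun v' =>
      (smul_of_smul_halfTree_subset θ hz' g v').imp
        (fun h => by
          have := Set.smul_set_mono (a := s) h
          rwa [hsu, smul_smul, mul_inv_cancel_left] at this)
        (fun h => by
          have := Set.smul_set_mono (a := s) h
          rwa [hsu, Set.smul_set_compl, smul_smul, mul_inv_cancel_left] at this)
    constructor
    · rw [EdgeIn, mul_smul]
      exact h (-1)
    · rw [EdgeIn, mul_smul, mul_smul, ht, Set.smul_set_compl, Set.smul_set_compl, compl_compl]
      exact (h 1).symm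
  -- The endpoints of the edge `x` are the vertices of `x` and `x * t⁻¹`.
  have h1 := key x (-1) (hs ▸ h)
  have h2 := key (x * t⁻¹) 1 ?_
  · refine ⟨h1.1, h1.2, ?_, ?_⟩
    · simpa only [mul_assoc] using h2.1
    · simpa only [mul_assoc] using h2.2
  · have : (x * t⁻¹) • halfTree d 1 = (x • halfTree d (-1))ᶜ := by
      rw [mul_smul, ← Set.smul_set_compl, smul_left_cancel_iff, inv_smul_eq_iff,
        Set.smul_set_compl, ht, compl_compl]
    rw [this, compl_compl]
    exact (hs ▸ h).symm

theorem mem_conj_smul {L : Type*} [Group L] {S : Subgroup L} {a γ : L} :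
    γ ∈ MulAut.conj a • S ↔ a⁻¹ * γ * a ∈ S := by
  rw [Subgroup.mem_pointwise_smul_iff_inv_smul_mem, ← map_inv, MulAut.smul_def,
    MulAut.conj_apply, inv_inv]

/-- The elements `y` enumerate the edges sharing a vertex with the base edge, so the fixed ball
grows by one. -/
theorem mem_hnnSeq_succ {γ : Γ} {k : ℕ} :
    γ ∈ hnnSeq θ (k + 1) ↔ ∀ g : G, ∀ y ∈ ({of g, of g * t, t⁻¹ * of g, t⁻¹ * of g * t} : Set Γ),
      y⁻¹ * γ * y ∈ hnnSeq θ k := by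
  simp only [hnnSeq, hnnCore, hnnPrime, hnnTau, Subgroup.mem_inf, Subgroup.mem_iInf, mem_conj_smul,
    Set.mem_insert_iff, Set.mem_singleton_iff, forall_eq_or_imp, forall_eq, mul_inv_rev, inv_inv,
    mul_assoc, forall_and]
  tauto

/-- An edge `k` steps deep has its whole `k`-ball inside the fixed half-tree. -/
theorem mem_hnnSeq_of_edgeIn {γ : Γ} {u : ℤˣ}
    (hγ : ∀ x : Γ, EdgeIn θ x (halfTree d u) → x⁻¹ * γ * x ∈ hnnSeq θ 0) (k : ℕ) :
    ∀ x : Γ, EdgeIn θ x ((t ^ (u : ℤ) : Γ) ^ k • halfTree d u) → x⁻¹ * γ * x ∈ hnnSeq θ k := by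
  obtain ⟨s, hs⟩ : ∃ s : Γ, s = t ^ (u : ℤ) := ⟨_, rfl⟩
  rw [← hs]
  induction k with
  | zero => simpa using hγ
  | succ k ih =>
    intro x hx
    rw [mem_hnnSeq_succ]
    intro g y hy
    suffices h : EdgeIn θ (x * y) (s ^ k • halfTree d u) by
      simpa [mul_assoc] using ih _ h
    have hx' : EdgeIn θ (s ^ k * ((s ^ k)⁻¹ * x)) (s ^ k • s • halfTree d u) := by
      rwa [mul_inv_cancel_left, smul_smul, ← pow_succ]
    rw [edgeIn_mul_smul, hs] at hx'
    have h := EdgeIn.adjacent θ hx' g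
    rw [← hs] at h
    have : EdgeIn θ ((s ^ k)⁻¹ * x * y) (halfTree d u) := by
      rcases hy with rfl | rfl | rfl | rfl
      exacts [h.1, h.2.1, h.2.2.1, h.2.2.2]
    rw [← edgeIn_mul_smul (a := s ^ k)] at this
    simpa [mul_assoc] using this

theorem exists_edgeIn (a : Γ) (u : ℤˣ) : ∃ x : Γ, EdgeIn θ x (a • halfTree d u) := by
  rcases Int.units_eq_one_or u with rfl | rfl
  -- Edges are recorded through `halfTree d (-1)`; the factor `t` turns it into the complement of
  -- `halfTree d 1`.
  · refine ⟨a * t, edgeIn_mul_smul θ |>.2 (Or.inr ?_)⟩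
    have := t_zpow_smul_halfTree θ (d := d) 1
    rw [Units.val_one, zpow_one] at this
    rw [this, compl_compl]
  · exact ⟨a, Or.inl subset_rfl⟩

theorem eq_one_of_smul_eq (hk : ∃ k : ℕ, hnnSeq θ k = ⊥) {γ : Γ} {u : ℤˣ}
    (hγ : ∀ W ∈ halfTrees θ d, W ⊆ halfTree d u → γ • W = W) : γ = 1 := by
  obtain ⟨k, hk⟩ := hk
  obtain ⟨x, hx⟩ := exists_edgeIn θ (d := d) ((t ^ (u : ℤ) : Γ) ^ k) u
  have := mem_hnnSeq_of_edgeIn θ (γ := γ) ?_ k x hx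
  · rw [hk, Subgroup.mem_bot] at this
    simpa using conj_eq_one_iff (a := x⁻¹) (b := γ) |>.1 (by simpa using this)
  · intro y hy
    have hfix : γ • y • halfTree d (-1) = y • halfTree d (-1) := by
      rcases hy with hy | hy
      · exact hγ _ (smul_halfTree_mem_halfTrees θ _ _) hy
      · have := hγ _ (compl_mem_halfTrees θ (smul_halfTree_mem_halfTrees θ y (-1))) hy
        rwa [Set.smul_set_compl, compl_inj_iff] at this
    obtain ⟨a, ha, hay⟩ := exists_of_smul_halfTree_eq θ (d := d) (γ := y⁻¹ * γ * y) (u := -1)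
      (by rw [mul_smul, mul_smul, hfix, inv_smul_smul])
    exact ⟨a, by simpa using ha, hay⟩

theorem isHalfSpaceSystem_halfTrees (hH : H ≠ ⊤) (hK : K ≠ ⊤) (hk : ∃ k : ℕ, hnnSeq θ k = ⊥) :
    IsHalfSpaceSystem Γ (halfTrees θ d) where
  nonempty := ⟨_, halfTree_mem_halfTrees θ 1⟩
  smul_mem γ _ hU := smul_mem_halfTrees θ γ hU
  exists_disjoint _ hU _ hV := exists_disjoint_halfTrees θ hH hK hU hV
  exists_disjoint_smul γ hγ U hU := by
    by_contra! hcon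
    obtain ⟨x, u, rfl⟩ := hU
    -- If nothing inside `U` is moved off itself, every half-tree inside `U` is fixed.
    have hfix : ∀ W ∈ halfTrees θ d, W ⊆ halfTree d u → (x⁻¹ * γ * x) • W = W := by
      intro W hW hWu
      rcases exists_disjoint_smul_or_eq θ hH hK γ (smul_mem_halfTrees θ x hW)
        with ⟨W', hW', hsub, hd⟩ | h
      · exact absurd hd (hcon W' hW' (hsub.trans (Set.smul_set_mono hWu)))
      · rw [mul_smul, mul_smul, h, inv_smul_smul]
    have := eq_one_of_smul_eq θ hk hfix
    exact hγ (by simpa using conj_eq_one_iff (a := x⁻¹) (b := γ) |>.1 (by simpa using this))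
  exists_pushesInto _ hU := exists_pushesInto_halfTrees θ hH hK hU

end HNNExtension

theorem proposition1p5 {G : Type*} [Group G] (H K : Subgroup G) (θ : H ≃* K)
    (hcount : Countable (HNNExtension G H K θ))
    (hH : H ≠ ⊤) (hK : K ≠ ⊤)
    (hk : ∃ k : ℕ, hnnSeq θ k = ⊥) :
    IsStronglyPowersGroup (HNNExtension G H K θ) := by
  obtain ⟨d⟩ := HNNExtension.NormalWord.TransversalPair.nonempty G H K
  exact (HNNExtension.isHalfSpaceSystem_halfTrees θ (d := d) hH hK hk).isStronglyPowersGroup
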